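/- Conventions. Let $(X,d)$ be a metric space; $B(x,r)$ denotes the closed ball of centre $x$ and radius $r\ge 0$, $d(x,A)=\inf_{a\in A}d(x,a)$ with $d(x,\emptyset)=\infty$, and families of balls are non-empty and of arbitrary cardinality. A set $A\subset X$ is *hyperconvex* if for every family of balls $\{B(x_i,r_i)\}_{i\in I}$ with $x_i\in A$ and $d(x_i,x_j)\le r_i+r_j$ for all $i,j$, we have $A\cap\bigcap_i B(x_i,r_i)\ne\emptyset$. For $A\subset Y\subset X$, the set $A$ is *externally hyperconvex in $Y$* if for every family of balls $\{B(x_i,r_i)\}_{i\in I}$ with $x_i\in Y$, $d(x_i,A)\le r_i$ and $d(x_i,x_j)\le r_i+r_j$ for all $i,j$, we have $A\cap\bigcap_i B(x_i,r_i)\neq\emptyset$; it is *weakly externally hyperconvex in $Y$* if for every $y\in Y$ it is externally hyperconvex in $A\cup\{y\}$. The set $A$ is *uniformly locally (weakly) externally hyperconvex* if there is $r>0$ such that for every $x\in A$ the set $A\cap B(x,r)$ is (weakly) externally hyperconvex in $B(x,r)$. A *geodesic bicombing* on $X$ is a map $\sigma\colon X\times X\times[0,1]\to X$, $\sigma_{xy}(t)=\sigma(x,y,t)$,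 such that for all $x,y,x',y'\in X$ and $s,t\in[0,1]$: $\sigma_{xy}(0)=x$, $\sigma_{xy}(1)=y$, $d(\sigma_{xy}(s),\sigma_{xy}(t))=|s-t|\,d(x,y)$, $\sigma_{yx}(t)=\sigma_{xy}(1-t)$, and $d(\sigma_{xy}(t),\sigma_{x'y'}(t))\le(1-t)d(x,x')+t\,d(y,y')$. It is *convex* if $t\mapsto d(\sigma_{xy}(t),\sigma_{x'y'}(t))$ is convex on $[0,1]$ for all $x,y,x',y'\in X$, and *consistent* if for all $x,y\in X$ and $0\le s\le t\le1$, with $x'=\sigma_{xy}(s)$ and $y'=\sigma_{xy}(t)$, we have $\sigma_{x'y'}([0,1])\subset\sigma_{xy}([0,1])$. A set $A\subset X$ is *$\sigma$-convex* if $\sigma_{xy}([0,1])\subset A$ for all $x,y\in A$. A curve $c\colon[0,1]\to X$ is *straight* if $t\mapsto d(z,c(t))$ is convex for every $z\in X$; straight curves in $X$ are *unique* if any two straight curves $[0,1]\to X$ with the same initial point and the same end point are equal. **Theorem.** Let $X$ be a hyperconvex metric space, let $A\subset X$ be any subset, and let $\sigma$ be a convex geodesic bicombing on $X$. (I) The following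 are equivalent: (i) $A$ is externally hyperconvex in $X$; (ii) $A$ is $\sigma$-convex and uniformly locally externally hyperconvex. (II) If straight curves in $X$ are unique, the following are equivalent: (i) $A$ is weakly externally hyperconvex in $X$ and there is a consistent geodesic bicombing on the metric space $A$ (with the induced metric); (ii) $A$ is $\sigma$-convex and uniformly locally weakly externally hyperconvex. -/

import Mathlib

universe u

namespace Bicombing

/-! Families of balls are indexed by non-empty types in the universe of the ambient space; since
`X × ℝ` lives in that universe, this covers families of balls of arbitrary size. -/

/-- A subset `A` of a metric space is hyperconvex: every family of closed balls `B(x i, r i)` with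
centres in `A` and `d(x i, x j) ≤ r i + r j` has a common point in `A`. -/
def IsHyperconvex {X : Type u} [MetricSpace X] (A : Set X) : Prop :=
  ∀ (ι : Type u) [Nonempty ι] (x : ι → X) (r : ι → ℝ),
    (∀ i, 0 ≤ r i) → (∀ i, x i ∈ A) → (∀ i j, dist (x i) (x j) ≤ r i + r j) →
    ((⋂ i, Metric.closedBall (x i) (r i)) ∩ A).Nonempty

/-- `A` is externally hyperconvex in `Y` (where `A ⊆ Y ⊆ X`): every family of closed balls
`B(x i, r i)` with centres in `Y`, `d(x i, A) ≤ r i` and `d(x i, x j) ≤ r i + r j` has a common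
point in `A`. The distance to `A` is extended-valued, so that `d(x, ∅) = ∞`. -/
def IsExternallyHyperconvexIn {X : Type u} [MetricSpace X] (A Y : Set X) : Prop :=
  ∀ (ι : Type u) [Nonempty ι] (x : ι → X) (r : ι → ℝ),
    (∀ i, 0 ≤ r i) → (∀ i, x i ∈ Y) → (∀ i, Metric.infEDist (x i) A ≤ ENNReal.ofReal (r i)) →
    (∀ i j, dist (x i) (x j) ≤ r i + r j) →
    ((⋂ i, Metric.closedBall (x i) (r i)) ∩ A).Nonempty

/-- `A` is weakly externally hyperconvex in `Y`: for every `y ∈ Y`, the set `A` is externally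
hyperconvex in `A ∪ {y}`. -/
def IsWeaklyExternallyHyperconvexIn {X : Type u} [MetricSpace X] (A Y : Set X) : Prop :=
  ∀ y ∈ Y, IsExternallyHyperconvexIn A (A ∪ {y})

/-- `A` is uniformly locally externally hyperconvex. -/
def IsUniformlyLocallyExternallyHyperconvex {X : Type u} [MetricSpace X] (A : Set X) : Prop :=
  ∃ r : ℝ, 0 < r ∧ ∀ x ∈ A,
    IsExternallyHyperconvexIn (A ∩ Metric.closedBall x r) (Metric.closedBall x r)

/-- `A` is uniformly locally weakly externally hyperconvex. -/
def IsUniformlyLocallyWeaklyExternallyHyperconvex {X : Type u} [MetricSpace X] (A : Set X) :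
    Prop :=
  ∃ r : ℝ, 0 < r ∧ ∀ x ∈ A,
    IsWeaklyExternallyHyperconvexIn (A ∩ Metric.closedBall x r) (Metric.closedBall x r)

/-- `σ` is a geodesic bicombing. Only the values `σ x y t` with `t ∈ [0, 1]` matter; values at other
parameters are unconstrained and never used. -/
structure IsGeodesicBicombing {X : Type u} [MetricSpace X] (σ : X → X → ℝ → X) : Prop where
  start : ∀ x y, σ x y 0 = x
  finish : ∀ x y, σ x y 1 = y
  constant_speed : ∀ x y, ∀ s ∈ Set.Icc (0 : ℝ) 1, ∀ t ∈ Set.Icc (0 : ℝ) 1,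
    dist (σ x y s) (σ x y t) = |s - t| * dist x y
  symmetric : ∀ x y, ∀ t ∈ Set.Icc (0 : ℝ) 1, σ y x t = σ x y (1 - t)
  weakly_convex : ∀ x y x' y', ∀ t ∈ Set.Icc (0 : ℝ) 1,
    dist (σ x y t) (σ x' y' t) ≤ (1 - t) * dist x x' + t * dist y y'

/-- A convex geodesic bicombing. -/
structure IsConvexGeodesicBicombing {X : Type u} [MetricSpace X] (σ : X → X → ℝ → X) : Prop
    extends IsGeodesicBicombing σ where
  convex : ∀ x y x' y', ConvexOn ℝ (Set.Icc (0 : ℝ) 1) (fun t => dist (σ x y t) (σ x' y' t))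

/-- A consistent geodesic bicombing. -/
structure IsConsistentGeodesicBicombing {X : Type u} [MetricSpace X] (σ : X → X → ℝ → X) : Prop
    extends IsGeodesicBicombing σ where
  consistent : ∀ x y, ∀ s t : ℝ, 0 ≤ s → s ≤ t → t ≤ 1 →
    σ (σ x y s) (σ x y t) '' Set.Icc 0 1 ⊆ σ x y '' Set.Icc 0 1

/-- `A` is `σ`-convex. -/
def IsSigmaConvex {X : Type u} (σ : X → X → ℝ → X) (A : Set X) : Prop :=
  ∀ x ∈ A, ∀ y ∈ A, σ x y '' Set.Icc 0 1 ⊆ A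

/-- The curve `c` restricted to `[0, 1]` is straight in `X`. -/
def IsStraight {X : Type u} [MetricSpace X] (c : ℝ → X) : Prop :=
  ∀ z : X, ConvexOn ℝ (Set.Icc (0 : ℝ) 1) (fun t => dist z (c t))

/-- Straight curves in `X` are determined on `[0, 1]` by their endpoints. -/
def HasUniqueStraightCurves (X : Type u) [MetricSpace X] : Prop :=
  ∀ c c' : ℝ → X, IsStraight c → IsStraight c' → c 0 = c' 0 → c 1 = c' 1 →
    Set.EqOn c c' (Set.Icc 0 1)

end Bicombing

/-! ### Families of balls, completeness and closedness -/

namespace Bicombing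

open Metric Set Filter Topology

variable {X : Type u} [MetricSpace X]

/-! From local to global: let `a ∈ A` satisfy `dist a (x i) ≤ r i + δ` for all `i`. Contracting the
family towards `a` along `σ` by a small factor `l` brings all centres into the ball where the local
hypothesis applies, while σ-convexity keeps the contracted balls close enough to `A`. The resulting
point of `A` has excess `(1 - l) * δ` and lies within `l * δ` of `a`, so iteration converges
(`exists_mem_of_bounded_radii`). A uniform `l` needs bounded radii. In general, hyperconvexity of
`X` or the bounded case itself supplies smaller balls of bounded radius inside the given ones, still
pairwise compatible and close enough to `A`.

From global to local: adjoining one ball to a family gives the local property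
(`IsExternallyHyperconvexIn.inter_closedBall`). For σ-convexity, the distance to an externally
hyperconvex set is convex along straight curves (`IsExternallyHyperconvexIn.convexOn_infDist`), so
it vanishes between two points of the set. In the weak case the same fact shows that curves straight
in `A` are straight in `X`; uniqueness then identifies the curves of a consistent bicombing on `A`
with those of `σ`. Uniqueness also makes the restriction of `σ` to `A` consistent. -/

lemma infEDist_le_ofReal_iff {A : Set X} {x : X} {r : ℝ} (hr : 0 ≤ r) :
    infEDist x A ≤ ENNReal.ofReal r ↔ ∀ ε > 0, ∃ b ∈ A, dist x b < r + ε := by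
  constructor
  · intro h ε hε
    have : infEDist x A < ENNReal.ofReal (r + ε) :=
      h.trans_lt ((ENNReal.ofReal_lt_ofReal_iff (by linarith)).2 (by linarith))
    obtain ⟨b, hb, hlt⟩ := infEDist_lt_iff.1 this
    exact ⟨b, hb, edist_lt_ofReal.1 hlt⟩
  · intro h
    refine ENNReal.le_of_forall_pos_le_add fun ε hε _ => ?_
    obtain ⟨b, hb, hlt⟩ := h ε hε
    refine (infEDist_le_edist_of_mem hb).trans ?_
    rw [edist_dist, ← ENNReal.ofReal_coe_nnreal, ← ENNReal.ofReal_add hr ε.coe_nonneg]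
    exact ENNReal.ofReal_le_ofReal hlt.le

/-- Passing to the set of pairs (centre, radius) frees the index type from the universe `u`, so
`Unit`, `Option ι` and subtypes of `ℝ` can index families. -/
lemma IsExternallyHyperconvexIn.exists_mem {A Y : Set X} (h : IsExternallyHyperconvexIn A Y)
    {ι : Type*} [Nonempty ι] (x : ι → X) (r : ι → ℝ) (hr : ∀ i, 0 ≤ r i) (hY : ∀ i, x i ∈ Y)
    (hA : ∀ i, ∀ ε > 0, ∃ b ∈ A, dist (x i) b < r i + ε)
    (hx : ∀ i j, dist (x i) (x j) ≤ r i + r j) : ∃ a ∈ A, ∀ i, dist a (x i) ≤ r i := by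
  let S : Set (X × ℝ) := range fun i => (x i, r i)
  obtain ⟨a, ha, haA⟩ := h S (fun p => p.1.1) (fun p => p.1.2)
    (by rintro ⟨_, i, rfl⟩; exact hr i) (by rintro ⟨_, i, rfl⟩; exact hY i)
    (by rintro ⟨_, i, rfl⟩; exact (infEDist_le_ofReal_iff (hr i)).2 (hA i))
    (by rintro ⟨_, i, rfl⟩ ⟨_, j, rfl⟩; exact hx i j)
  exact ⟨a, haA, fun i => mem_iInter.1 ha ⟨_, i, rfl⟩⟩

lemma isExternallyHyperconvexIn_of_exists {A Y : Set X}
    (h : ∀ (ι : Type u) [Nonempty ι] (x : ι → X) (r : ι → ℝ), (∀ i, 0 ≤ r i) → (∀ i, x i ∈ Y) →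
      (∀ i, ∀ ε > 0, ∃ b ∈ A, dist (x i) b < r i + ε) →
      (∀ i j, dist (x i) (x j) ≤ r i + r j) → ∃ a ∈ A, ∀ i, dist a (x i) ≤ r i) :
    IsExternallyHyperconvexIn A Y := by
  intro ι _ x r hr hY hA hx
  obtain ⟨a, ha, hax⟩ := h ι x r hr hY (fun i => (infEDist_le_ofReal_iff (hr i)).1 (hA i)) hx
  exact ⟨a, mem_iInter.2 hax, ha⟩

lemma IsHyperconvex.exists_mem {A : Set X} (h : IsHyperconvex A)
    {ι : Type*} [Nonempty ι] (x : ι → X) (r : ι → ℝ) (hr : ∀ i, 0 ≤ r i) (hA : ∀ i, x i ∈ A)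
    (hx : ∀ i j, dist (x i) (x j) ≤ r i + r j) : ∃ a ∈ A, ∀ i, dist a (x i) ≤ r i := by
  let S : Set (X × ℝ) := range fun i => (x i, r i)
  obtain ⟨a, ha, haA⟩ := h S (fun p => p.1.1) (fun p => p.1.2)
    (by rintro ⟨_, i, rfl⟩; exact hr i) (by rintro ⟨_, i, rfl⟩; exact hA i)
    (by rintro ⟨_, i, rfl⟩ ⟨_, j, rfl⟩; exact hx i j)
  exact ⟨a, haA, fun i => mem_iInter.1 ha ⟨_, i, rfl⟩⟩

lemma IsExternallyHyperconvexIn.mono {A Y Z : Set X} (h : IsExternallyHyperconvexIn A Z)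
    (hYZ : Y ⊆ Z) : IsExternallyHyperconvexIn A Y :=
  fun ι _ x r hr hY => h ι x r hr fun i => hYZ (hY i)

lemma exists_dist_lt_of_dist_le {A : Set X} {x b : X} {r : ℝ} (hb : b ∈ A) (h : dist x b ≤ r) :
    ∀ ε > 0, ∃ b ∈ A, dist x b < r + ε := fun ε hε => ⟨b, hb, by linarith⟩

/-- Hyperconvex metric spaces are complete. -/
lemma IsHyperconvex.completeSpace (h : IsHyperconvex (univ : Set X)) : CompleteSpace X := by
  refine Metric.complete_of_convergent_controlled_sequences (fun n => (1 / 2 : ℝ) ^ n)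
    (fun n => by positivity) fun u hu => ?_
  have key : ∀ m n, m ≤ n → dist (u m) (u n) ≤ (1 / 2 : ℝ) ^ m + (1 / 2 : ℝ) ^ n := fun m n hmn =>
    (hu m m n le_rfl hmn).le.trans (by have : (0 : ℝ) ≤ (1 / 2 : ℝ) ^ n := by positivity
                                       linarith)
  obtain ⟨a, -, ha⟩ := h.exists_mem u (fun n => (1 / 2 : ℝ) ^ n) (fun n => by positivity)
    (fun _ => mem_univ _) (fun m n => by
      rcases le_total m n with hmn | hmn
      · exact key m n hmn
      · rw [dist_comm, add_comm]; exact key n m hmn)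
  refine ⟨a, tendsto_iff_dist_tendsto_zero.2 ?_⟩
  refine squeeze_zero (fun _ => dist_nonneg) (fun n => ?_)
    (tendsto_pow_atTop_nhds_zero_of_lt_one (by norm_num : (0 : ℝ) ≤ 1 / 2) (by norm_num))
  rw [dist_comm]; exact ha n

lemma IsUniformlyLocallyExternallyHyperconvex.weakly {A : Set X}
    (h : IsUniformlyLocallyExternallyHyperconvex A) :
    IsUniformlyLocallyWeaklyExternallyHyperconvex A := by
  obtain ⟨ρ, hρ, h⟩ := h
  refine ⟨ρ, hρ, fun x hx y hy => (h x hx).mono ?_⟩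
  exact union_subset inter_subset_right (singleton_subset_iff.2 hy)

/-- A limit point `p` is the centre of a one-ball family of radius `0`, whose common point can only
be `p`. -/
lemma IsUniformlyLocallyWeaklyExternallyHyperconvex.isClosed {A : Set X}
    (h : IsUniformlyLocallyWeaklyExternallyHyperconvex A) : IsClosed A := by
  obtain ⟨ρ, hρ, h⟩ := h
  refine isClosed_of_closure_subset fun p hp => ?_
  obtain ⟨a, ha, hpa⟩ := Metric.mem_closure_iff.1 hp (ρ / 2) (by linarith)
  obtain ⟨b, hb, hbp⟩ := (h a ha p (by rw [mem_closedBall]; linarith)).exists_mem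
    (fun _ : Unit => p) (fun _ => 0) (fun _ => le_rfl) (fun _ => Or.inr rfl)
    (fun _ ε hε => by
      obtain ⟨c, hc, hpc⟩ := Metric.mem_closure_iff.1 hp (min ε (ρ / 2)) (by positivity)
      have h1 := hpc.trans_le (min_le_left _ _)
      have h2 := hpc.trans_le (min_le_right _ _)
      refine ⟨c, ⟨hc, ?_⟩, by linarith⟩
      rw [mem_closedBall]
      have := dist_triangle_left c a p
      linarith)
    (by simp)
  have : b = p := dist_le_zero.1 (hbp ())
  exact this ▸ hb.1

/-! ### From local to global: families of bounded radii -/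

section Bicombing

variable {σ : X → X → ℝ → X}

lemma IsGeodesicBicombing.const (hσ : IsGeodesicBicombing σ) (x : X) {t : ℝ}
    (ht : t ∈ Icc (0 : ℝ) 1) : σ x x t = x := by
  have h := hσ.constant_speed x x t ht 0 (by simp)
  rw [hσ.start, dist_self, mul_zero] at h
  exact dist_le_zero.1 h.le

lemma IsGeodesicBicombing.dist_start (hσ : IsGeodesicBicombing σ) (x y : X) {t : ℝ}
    (ht : t ∈ Icc (0 : ℝ) 1) : dist x (σ x y t) = t * dist x y := by
  have h := hσ.constant_speed x y 0 (by simp) t ht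
  rwa [hσ.start, zero_sub, abs_neg, abs_of_nonneg ht.1] at h

lemma IsGeodesicBicombing.dist_finish (hσ : IsGeodesicBicombing σ) (x y : X) {t : ℝ}
    (ht : t ∈ Icc (0 : ℝ) 1) : dist (σ x y t) y = (1 - t) * dist x y := by
  have h := hσ.constant_speed x y t ht 1 (by simp)
  rwa [hσ.finish, abs_sub_comm, abs_of_nonneg (by linarith [ht.2])] at h

lemma IsGeodesicBicombing.dist_le_of_same_start (hσ : IsGeodesicBicombing σ) (a x y : X) {t : ℝ}
    (ht : t ∈ Icc (0 : ℝ) 1) : dist (σ a x t) (σ a y t) ≤ t * dist x y := by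
  simpa using hσ.weakly_convex a x a y t ht

lemma IsGeodesicBicombing.continuousOn (hσ : IsGeodesicBicombing σ) (x y : X) :
    ContinuousOn (σ x y) (Icc 0 1) := by
  refine LipschitzOnWith.continuousOn (K := nndist x y) (LipschitzOnWith.of_dist_le_mul ?_)
  intro s hs t ht
  rw [hσ.constant_speed x y s hs t ht, mul_comm]
  rfl

lemma IsConvexGeodesicBicombing.isStraight (hσ : IsConvexGeodesicBicombing σ) (x y : X) :
    IsStraight (σ x y) := fun z =>
  (hσ.convex z z x y).congr fun t ht => by simp only [hσ.const z ht]

/-- One step of the iteration: an approximate common point `a ∈ A` with excess `δ` is moved by at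
most `l * δ` to one with excess `(1 - l) * δ`. -/
lemma exists_mem_excess_le (hσ : IsGeodesicBicombing σ) {A : Set X} (hconv : IsSigmaConvex σ A)
    {ρ : ℝ} {ι : Type*} (x : ι → X) (r : ι → ℝ) (hr : ∀ i, 0 ≤ r i)
    (hA : ∀ i, ∀ ε > 0, ∃ b ∈ A, dist (x i) b < r i + ε)
    (hx : ∀ i j, dist (x i) (x j) ≤ r i + r j)
    {a : X} (ha : a ∈ A) {l δ : ℝ} (hl : l ∈ Ioc (0 : ℝ) 1) (hδ : 0 ≤ δ)
    (hax : ∀ i, dist a (x i) ≤ r i + δ) (hlρ : ∀ i, l * (r i + δ + r i + 1) ≤ ρ) (hρ : 0 < ρ)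
    (hloc : IsExternallyHyperconvexIn (A ∩ closedBall a ρ)
      ((A ∩ closedBall a ρ) ∪ range fun i => σ a (x i) l)) :
    ∃ a' ∈ A, dist a a' ≤ l * δ ∧ ∀ i, dist a' (x i) ≤ r i + (1 - l) * δ := by
  have hl' : l ∈ Icc (0 : ℝ) 1 := ⟨hl.1.le, hl.2⟩
  have haB : a ∈ A ∩ closedBall a ρ := ⟨ha, mem_closedBall_self hρ.le⟩
  have hac : ∀ i, dist a (σ a (x i) l) ≤ l * δ + l * r i := fun i => by
    rw [hσ.dist_start _ _ hl']
    nlinarith [mul_le_mul_of_nonneg_left (hax i) hl.1.le]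
  -- The family contracted towards `a` by the factor `l`, together with a ball of radius `l * δ`
  -- about `a` that bounds the displacement.
  obtain ⟨b, hb, hbx⟩ := hloc.exists_mem (ι := Option ι)
    (fun o => o.elim a fun i => σ a (x i) l) (fun o => o.elim (l * δ) fun i => l * r i)
    (by rintro (_ | i)
        · exact mul_nonneg hl.1.le hδ
        · exact mul_nonneg hl.1.le (hr i))
    (by rintro (_ | i)
        · exact Or.inl haB
        · exact Or.inr ⟨i, rfl⟩)
    (by rintro (_ | i)
        · exact exists_dist_lt_of_dist_le haB (by simpa using mul_nonneg hl.1.le hδ)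
        · intro ε hε
          -- The slack is capped at `1` so that the contracted point stays in the `ρ`-ball; this is
          -- the `+ 1` in `hlρ`.
          obtain ⟨c, hc, hxc⟩ := hA i (min ε 1) (by positivity)
          have h1 := min_le_left ε 1
          have h2 := min_le_right ε 1
          refine ⟨σ a c l, ⟨hconv a ha c hc ⟨l, hl', rfl⟩, ?_⟩, ?_⟩
          · rw [mem_closedBall', hσ.dist_start _ _ hl']
            refine le_trans (mul_le_mul_of_nonneg_left ?_ hl.1.le) (hlρ i)
            have := dist_triangle a (x i) c
            linarith [hax i]
          · refine (hσ.dist_le_of_same_start a (x i) c hl').trans_lt ?_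
            have := mul_lt_mul_of_pos_left hxc hl.1
            have : l * min ε 1 ≤ ε := by
              have : 0 ≤ min ε 1 := by positivity
              nlinarith [hl.2]
            simp only [Option.elim]
            linarith)
    (by rintro (_ | i) (_ | j)
        · simpa using mul_nonneg hl.1.le hδ
        · exact hac j
        · simpa [dist_comm, add_comm] using hac i
        · have := hσ.dist_le_of_same_start a (x i) (x j) hl'
          have h2 := mul_le_mul_of_nonneg_left (hx i j) hl.1.le
          simp only [Option.elim]
          linarith)
  refine ⟨b, hb.1, by rw [dist_comm]; exact hbx none, fun i => ?_⟩
  have h1 : dist b (σ a (x i) l) ≤ l * r i := hbx (some i)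
  have h2 := hσ.dist_finish a (x i) hl'
  have h3 := mul_le_mul_of_nonneg_left (hax i) (sub_nonneg.2 hl.2)
  have := dist_triangle b (σ a (x i) l) (x i)
  linarith

/-- Local external hyperconvexity of a `σ`-convex set yields common points for families of balls of
bounded radii. -/
lemma exists_mem_of_bounded_radii [CompleteSpace X] (hσ : IsGeodesicBicombing σ) {A : Set X}
    (hcl : IsClosed A) (hconv : IsSigmaConvex σ A) {ρ : ℝ} (hρ : 0 < ρ)
    {ι : Type*} [Nonempty ι] (x : ι → X) (r : ι → ℝ) {K : ℝ}
    (hr : ∀ i, 0 ≤ r i) (hK : ∀ i, r i ≤ K)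
    (hA : ∀ i, ∀ ε > 0, ∃ b ∈ A, dist (x i) b < r i + ε)
    (hx : ∀ i j, dist (x i) (x j) ≤ r i + r j)
    (hloc : ∀ a ∈ A, ∀ l ∈ Ioc (0 : ℝ) 1, (∀ i, l * dist a (x i) ≤ ρ) →
      IsExternallyHyperconvexIn (A ∩ closedBall a ρ)
        ((A ∩ closedBall a ρ) ∪ range fun i => σ a (x i) l)) :
    ∃ a ∈ A, ∀ i, dist a (x i) ≤ r i := by
  obtain ⟨i₀⟩ := ‹Nonempty ι›
  have hK0 : 0 ≤ K := (hr i₀).trans (hK i₀)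
  obtain ⟨a₀, ha₀, hxa₀⟩ := hA i₀ 1 one_pos
  -- Initial excess: `a₀` is within `r i₀ + 1` of `x i₀`, which is within `r i₀ + r i` of `x i`.
  set δ : ℝ := 2 * K + 1 with hδ
  have hδ0 : 0 < δ := by linarith
  set l : ℝ := min (1 / 2) (ρ / (2 * K + δ + 1)) with hl
  have hl0 : 0 < l := by positivity
  have hl1 : l ≤ 1 / 2 := min_le_left _ _
  have hlmem : l ∈ Ioc (0 : ℝ) 1 := ⟨hl0, by linarith⟩
  have hlρ : l * (2 * K + δ + 1) ≤ ρ := (le_div_iff₀ (by positivity)).1 (min_le_right _ _)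
  have step : ∀ (n : ℕ) (a : {a // a ∈ A ∧ ∀ i, dist a (x i) ≤ r i + (1 - l) ^ n * δ}),
      ∃ a' : X, (a' ∈ A ∧ ∀ i, dist a' (x i) ≤ r i + (1 - l) ^ (n + 1) * δ) ∧
        dist a.1 a' ≤ l * δ * (1 - l) ^ n := by
    rintro n ⟨a, ha, hax⟩
    have hp0 : 0 ≤ (1 - l) ^ n := pow_nonneg (by linarith) n
    have hp1 : (1 - l) ^ n ≤ 1 := pow_le_one₀ (by linarith) (by linarith)
    have hp2 : (1 - l) ^ n * δ ≤ δ := by nlinarith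
    obtain ⟨a', ha', hd, hax'⟩ := exists_mem_excess_le hσ hconv x r hr hA hx ha hlmem
      (by positivity) hax (fun i => le_trans
        (mul_le_mul_of_nonneg_left (by linarith [hK i]) hl0.le) hlρ) hρ
      (hloc a ha l hlmem fun i => le_trans
        (mul_le_mul_of_nonneg_left (by linarith [hK i, hax i]) hl0.le) hlρ)
    refine ⟨a', ⟨ha', fun i => (hax' i).trans (le_of_eq ?_)⟩, hd.trans (le_of_eq ?_)⟩ <;> ring
  choose f hf hfd using step
  let u : ∀ n : ℕ, {a // a ∈ A ∧ ∀ i, dist a (x i) ≤ r i + (1 - l) ^ n * δ} := fun n =>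
    Nat.rec ⟨a₀, ha₀, fun i => by
      have h1 := dist_triangle a₀ (x i₀) (x i)
      rw [dist_comm a₀ (x i₀)] at h1
      simp only [pow_zero, one_mul]
      linarith [hx i₀ i, hK i₀]⟩ (fun n a => ⟨f n a, hf n a⟩) n
  have hcau : CauchySeq fun n => (u n).1 :=
    cauchySeq_of_le_geometric (1 - l) (l * δ) (by linarith) fun n => hfd n (u n)
  obtain ⟨a, ha⟩ := cauchySeq_tendsto_of_complete hcau
  refine ⟨a, hcl.mem_of_tendsto ha (Eventually.of_forall fun n => (u n).2.1), fun i => ?_⟩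
  have hlim : Tendsto (fun n : ℕ => r i + (1 - l) ^ n * δ) atTop (𝓝 (r i + 0 * δ)) :=
    ((tendsto_pow_atTop_nhds_zero_of_lt_one (by linarith) (by linarith)).mul_const _).const_add _
  simpa using le_of_tendsto_of_tendsto' (ha.dist tendsto_const_nhds) hlim fun n => (u n).2.2 i

lemma IsUniformlyLocallyExternallyHyperconvex.exists_mem_of_bounded_radii [CompleteSpace X]
    (hσ : IsGeodesicBicombing σ) {A : Set X} (h : IsUniformlyLocallyExternallyHyperconvex A)
    (hconv : IsSigmaConvex σ A) {ι : Type*} [Nonempty ι] (x : ι → X) (r : ι → ℝ) {K : ℝ}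
    (hr : ∀ i, 0 ≤ r i) (hK : ∀ i, r i ≤ K)
    (hA : ∀ i, ∀ ε > 0, ∃ b ∈ A, dist (x i) b < r i + ε)
    (hx : ∀ i j, dist (x i) (x j) ≤ r i + r j) : ∃ a ∈ A, ∀ i, dist a (x i) ≤ r i := by
  have hcl := h.weakly.isClosed
  obtain ⟨ρ, hρ, h⟩ := h
  refine Bicombing.exists_mem_of_bounded_radii hσ hcl hconv hρ x r hr hK hA hx
    fun a ha l hl hlρ => (h a ha).mono (union_subset inter_subset_right ?_)
  rintro _ ⟨i, rfl⟩
  rw [mem_closedBall', hσ.dist_start _ _ ⟨hl.1.le, hl.2⟩]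
  exact hlρ i

/-- Contracting a centre in `A` towards `a ∈ A` stays in `A` by σ-convexity, and all centres equal
to `y` contract to the single point `σ a y l`. Hence only one point outside `A` is ever needed. -/
lemma IsUniformlyLocallyWeaklyExternallyHyperconvex.exists_mem_of_bounded_radii [CompleteSpace X]
    (hσ : IsGeodesicBicombing σ) {A : Set X}
    (h : IsUniformlyLocallyWeaklyExternallyHyperconvex A)
    (hconv : IsSigmaConvex σ A) (y : X) {ι : Type*} [Nonempty ι] (x : ι → X) (r : ι → ℝ) {K : ℝ}
    (hxy : ∀ i, x i ∈ A ∪ {y}) (hr : ∀ i, 0 ≤ r i) (hK : ∀ i, r i ≤ K)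
    (hA : ∀ i, ∀ ε > 0, ∃ b ∈ A, dist (x i) b < r i + ε)
    (hx : ∀ i j, dist (x i) (x j) ≤ r i + r j) : ∃ a ∈ A, ∀ i, dist a (x i) ≤ r i := by
  have hcl := h.isClosed
  obtain ⟨ρ, hρ, h⟩ := h
  refine Bicombing.exists_mem_of_bounded_radii hσ hcl hconv hρ x r hr hK hA hx
    fun a ha l hl hlρ => ?_
  have hl' : l ∈ Icc (0 : ℝ) 1 := ⟨hl.1.le, hl.2⟩
  have hball : ∀ i, σ a (x i) l ∈ closedBall a ρ := fun i => by
    rw [mem_closedBall', hσ.dist_start _ _ hl']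
    exact hlρ i
  by_cases hy : ∃ i, x i = y
  · obtain ⟨j, hj⟩ := hy
    refine (h a ha (σ a y l) (hj ▸ hball j)).mono (union_subset subset_union_left ?_)
    rintro _ ⟨i, rfl⟩
    rcases hxy i with hi | hi
    · exact Or.inl ⟨hconv a ha _ hi ⟨l, hl', rfl⟩, hball i⟩
    · rw [mem_singleton_iff] at hi
      exact Or.inr (by simp [hi])
  · refine (h a ha a (mem_closedBall_self hρ.le)).mono (union_subset subset_union_left ?_)
    rintro _ ⟨i, rfl⟩
    exact Or.inl ⟨hconv a ha _ ((hxy i).resolve_right fun hi => hy ⟨i, hi⟩) ⟨l, hl', rfl⟩, hball i⟩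

/-! ### From local to global: unbounded radii -/

lemma IsUniformlyLocallyExternallyHyperconvex.isExternallyHyperconvexIn
    (hX : IsHyperconvex (univ : Set X)) (hσ : IsGeodesicBicombing σ) {A : Set X}
    (h : IsUniformlyLocallyExternallyHyperconvex A) (hconv : IsSigmaConvex σ A) :
    IsExternallyHyperconvexIn A univ := by
  have := hX.completeSpace
  refine isExternallyHyperconvexIn_of_exists fun ι hι x r hr _ hA hx => ?_
  obtain ⟨i₀⟩ := id hι
  obtain ⟨a₀, ha₀, hxa₀⟩ := hA i₀ 1 one_pos
  set δ : ℝ := 2 * r i₀ + 1 with hδ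
  have hδ0 : 0 < δ := by linarith [hr i₀]
  have ha₀x : ∀ i, dist a₀ (x i) ≤ δ + r i := fun i => by
    have h1 := dist_triangle a₀ (x i₀) (x i)
    rw [dist_comm a₀ (x i₀)] at h1
    linarith [hx i₀ i]
  obtain ⟨y, -, hy⟩ := hX.exists_mem (ι := Option ι) (fun o => o.elim a₀ x) (fun o => o.elim δ r)
    (by rintro (_ | i)
        · exact hδ0.le
        · exact hr i)
    (fun _ => mem_univ _)
    (by rintro (_ | i) (_ | j)
        · simpa using hδ0.le
        · exact ha₀x j
        · simpa [dist_comm, add_comm] using ha₀x i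
        · exact hx i j)
  have hya : dist y a₀ ≤ δ := hy none
  have hyx : ∀ i, dist y (x i) ≤ r i := fun i => hy (some i)
  have hb : ∀ i, ∃ b ∈ A, dist b a₀ ≤ δ ∧ dist b (x i) ≤ r i := fun i => by
    obtain ⟨b, hb, hbx⟩ := h.exists_mem_of_bounded_radii hσ hconv ![a₀, x i] ![δ, r i]
      (K := δ + r i) (by simp [Fin.forall_fin_two, hδ0.le, hr i])
      (by simp [Fin.forall_fin_two, hδ0.le, hr i])
      (Fin.forall_fin_two.2 ⟨exists_dist_lt_of_dist_le ha₀ (by simpa using hδ0.le), hA i⟩)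
      (by simpa [Fin.forall_fin_two, hδ0.le, hr i, dist_comm (x i), add_comm (r i)] using ha₀x i)
    exact ⟨b, hb, hbx 0, hbx 1⟩
  choose b hbA hba hbx using hb
  -- Each ball is replaced by a ball inside it of radius at most `2 * δ` containing `y` and `b i`.
  -- Containing `y` makes the new balls compatible; containing `b i` keeps them meeting `A`. The
  -- bound `2 * δ` works because `y` and `b i` are both within `δ` of `a₀`.
  have hx' : ∀ i, ∃ x', dist x' (x i) ≤ r i - min (r i) (2 * δ) ∧ dist x' y ≤ min (r i) (2 * δ) ∧
      dist x' (b i) ≤ min (r i) (2 * δ) := fun i => by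
    rcases le_total (r i) (2 * δ) with hi | hi
    · rw [min_eq_left hi]
      exact ⟨x i, by simp, by rw [dist_comm]; exact hyx i, by rw [dist_comm]; exact hbx i⟩
    · rw [min_eq_right hi]
      have hyb : dist y (b i) ≤ 2 * δ := by
        have := dist_triangle_right y (b i) a₀
        linarith [hba i]
      obtain ⟨x', -, hx'⟩ := hX.exists_mem ![x i, y, b i] ![r i - 2 * δ, 2 * δ, 2 * δ]
        (by simp [Fin.forall_fin_succ, hδ0.le, hi]) (fun _ => mem_univ _)
        (by
          have h1 : dist (x i) y ≤ r i := dist_comm y (x i) ▸ hyx i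
          have h2 : dist (x i) (b i) ≤ r i := dist_comm (b i) (x i) ▸ hbx i
          have h3 : dist (b i) y ≤ 2 * δ := dist_comm y (b i) ▸ hyb
          intro j k
          fin_cases j <;> fin_cases k <;> simp <;> linarith [hyx i, hbx i])
      exact ⟨x', hx' 0, hx' 1, hx' 2⟩
  choose x' hx'x hx'y hx'b using hx'
  obtain ⟨a, ha, hax⟩ := h.exists_mem_of_bounded_radii hσ hconv x' (fun i => min (r i) (2 * δ))
    (K := 2 * δ) (fun i => le_min (hr i) (by positivity)) (fun i => min_le_right _ _)
    (fun i => exists_dist_lt_of_dist_le (hbA i) (hx'b i))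
    (fun i j => (dist_triangle_right _ _ y).trans (add_le_add (hx'y i) (hx'y j)))
  refine ⟨a, ha, fun i => ?_⟩
  have := dist_triangle a (x' i) (x i)
  linarith [hax i, hx'x i]

/-- Radii are capped at `r i₀` by balls through a common point `y` of `X`. The new centres are found
in `A` by the bounded case for `A ∪ {y}`, since `x i₀` lies in `A` within `r i₀` of `y`. -/
lemma IsUniformlyLocallyWeaklyExternallyHyperconvex.isHyperconvex
    (hX : IsHyperconvex (univ : Set X)) (hσ : IsGeodesicBicombing σ) {A : Set X}
    (h : IsUniformlyLocallyWeaklyExternallyHyperconvex A) (hconv : IsSigmaConvex σ A) :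
    IsHyperconvex A := by
  have := hX.completeSpace
  intro ι hι x r hr hA hx
  obtain ⟨i₀⟩ := id hι
  obtain ⟨y, -, hy⟩ := hX.exists_mem x r hr (fun _ => mem_univ _) hx
  have hM : 0 ≤ r i₀ := hr i₀
  have hx' : ∀ i, ∃ x' ∈ A, dist x' (x i) ≤ r i - min (r i) (r i₀) ∧
      dist x' y ≤ min (r i) (r i₀) := fun i => by
    rcases le_total (r i) (r i₀) with hi | hi
    · rw [min_eq_left hi]
      exact ⟨x i, hA i, by simp, by rw [dist_comm]; exact hy i⟩
    · rw [min_eq_right hi]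
      obtain ⟨x', hx'A, hx'⟩ := h.exists_mem_of_bounded_radii hσ hconv y ![x i, y]
        ![r i - r i₀, r i₀] (K := r i) (by simp [Fin.forall_fin_two, hA i])
        (by simp [Fin.forall_fin_two, hi, hM]) (by simp [Fin.forall_fin_two, hi, hM])
        (Fin.forall_fin_two.2 ⟨exists_dist_lt_of_dist_le (hA i) (by simpa using hi),
          exists_dist_lt_of_dist_le (hA i₀) (hy i₀)⟩)
        (by simp [Fin.forall_fin_two, dist_comm (x i), hy i, hi, hM])
      exact ⟨x', hx'A, hx' 0, hx' 1⟩
  choose x' hx'A hx'x hx'y using hx'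
  obtain ⟨a, ha, hax⟩ := h.exists_mem_of_bounded_radii hσ hconv y x' (fun i => min (r i) (r i₀))
    (K := r i₀) (fun i => Or.inl (hx'A i)) (fun i => le_min (hr i) hM) (fun i => min_le_right _ _)
    (fun i => exists_dist_lt_of_dist_le (hx'A i) (by simpa using ⟨hr i, hM⟩))
    (fun i j => (dist_triangle_right _ _ y).trans (add_le_add (hx'y i) (hx'y j)))
  refine ⟨a, mem_iInter.2 fun i => ?_, ha⟩
  have := dist_triangle a (x' i) (x i)
  rw [mem_closedBall]
  linarith [hax i, hx'x i]

lemma IsUniformlyLocallyWeaklyExternallyHyperconvex.isWeaklyExternallyHyperconvexIn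
    (hX : IsHyperconvex (univ : Set X)) (hσ : IsGeodesicBicombing σ) {A : Set X}
    (h : IsUniformlyLocallyWeaklyExternallyHyperconvex A) (hconv : IsSigmaConvex σ A) :
    IsWeaklyExternallyHyperconvexIn A univ := by
  have := hX.completeSpace
  refine fun y _ => isExternallyHyperconvexIn_of_exists fun ι hι x r hr hxy hA hx => ?_
  obtain ⟨i₀⟩ := id hι
  -- The centres outside `A` all equal `y`; hyperconvexity of `A` handles the others. Radii are then
  -- capped at `dist b y`.
  obtain ⟨b, hb, hbx⟩ : ∃ b ∈ A, ∀ i, x i ∈ A → dist b (x i) ≤ r i := by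
    by_cases hne : Nonempty {i // x i ∈ A}
    · obtain ⟨b, hb, hbx⟩ := (h.isHyperconvex hX hσ hconv).exists_mem
        (fun i : {i // x i ∈ A} => x i) (fun i => r i) (fun i => hr i) (fun i => i.2)
        (fun i j => hx i j)
      exact ⟨b, hb, fun i hi => hbx ⟨i, hi⟩⟩
    · obtain ⟨b, hb, -⟩ := hA i₀ 1 one_pos
      exact ⟨b, hb, fun i hi => (hne ⟨i, hi⟩).elim⟩
  set M := dist b y with hM
  have hM0 : 0 ≤ M := dist_nonneg
  have hxy' : ∀ i, x i ∉ A → x i = y := fun i hi => (hxy i).resolve_left hi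
  have hout : ∀ i j, x i ∈ A → x j ∉ A → dist (x i) y ≤ r i + min (r j) M := fun i j hi hj => by
    rw [← min_add_add_left]
    refine le_min (hxy' j hj ▸ hx i j) ?_
    have := dist_triangle_left (x i) y b
    linarith [hbx i hi]
  -- The new balls centred in `A` all contain `b`, hence are compatible with one another; the last
  -- bound in the first implication makes them compatible with the capped balls about `y`.
  have hx' : ∀ i, ∃ x', dist x' (x i) ≤ r i - min (r i) M ∧
      (x i ∈ A → x' ∈ A ∧ dist x' b ≤ min (r i) M ∧
        ∀ j, x j ∉ A → dist x' y ≤ min (r i) M + min (r j) M) ∧ (x i ∉ A → x' = y) := fun i => by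
    by_cases hiA : x i ∈ A
    · rcases le_total (r i) M with hi | hi
      · rw [min_eq_left hi]
        exact ⟨x i, by simp, fun _ => ⟨hiA, by rw [dist_comm]; exact hbx i hiA,
          fun j hj => hout i j hiA hj⟩, fun h => (h hiA).elim⟩
      · rw [min_eq_right hi]
        have hj0 : ∀ j, 0 ≤ min (r j) M := fun j => le_min (hr j) hM0
        have h1 : ∀ j : {j // x j ∉ A}, dist (x i) y ≤ r i - M + (M + min (r j) M) := fun j => by
          linarith [hout i j hiA j.2]
        have h2 : ∀ j : {j // x j ∉ A}, dist b y ≤ M + (M + min (r j) M) := fun j => by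
          linarith [hj0 j]
        have h3 : dist (x i) b ≤ r i - M + M := by rw [dist_comm]; linarith [hbx i hiA]
        obtain ⟨x', hx'A, hx'⟩ := h.exists_mem_of_bounded_radii hσ hconv y
          (ι := Fin 2 ⊕ {j // x j ∉ A}) (Sum.elim ![x i, b] fun _ => y)
          (Sum.elim ![r i - M, M] fun j => M + min (r j) M) (K := r i + M)
          (Sum.forall.2 ⟨Fin.forall_fin_two.2 ⟨Or.inl hiA, Or.inl hb⟩, fun j => Or.inr rfl⟩)
          (Sum.forall.2 ⟨Fin.forall_fin_two.2 ⟨sub_nonneg.2 hi, hM0⟩,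
            fun j => add_nonneg hM0 (hj0 j)⟩)
          (Sum.forall.2 ⟨Fin.forall_fin_two.2
            ⟨show r i - M ≤ r i + M by linarith, show M ≤ r i + M by linarith [hr i]⟩,
            fun j => show M + min (r j) M ≤ r i + M by linarith [min_le_right (r j) M]⟩)
          (Sum.forall.2 ⟨Fin.forall_fin_two.2
            ⟨exists_dist_lt_of_dist_le hiA (by simpa using hi),
              exists_dist_lt_of_dist_le hb (by simpa using hM0)⟩,
            fun j => exists_dist_lt_of_dist_le hb
              (show dist y b ≤ M + min (r j) M by rw [dist_comm]; linarith [hj0 j])⟩)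
          (Sum.forall.2 ⟨Fin.forall_fin_two.2
            ⟨Sum.forall.2 ⟨Fin.forall_fin_two.2 ⟨by simpa using hi, h3⟩, h1⟩,
              Sum.forall.2 ⟨Fin.forall_fin_two.2
                ⟨by simpa [dist_comm, add_comm] using h3, by simpa using hM0⟩, h2⟩⟩,
            fun j => Sum.forall.2 ⟨Fin.forall_fin_two.2
              ⟨by rw [dist_comm, add_comm]; exact h1 j, by rw [dist_comm, add_comm]; exact h2 j⟩,
              fun k => by
                simp only [Sum.elim_inr, dist_self]
                linarith [hj0 j, hj0 k]⟩⟩)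
        exact ⟨x', hx' (.inl 0), fun _ => ⟨hx'A, hx' (.inl 1), fun j hj => hx' (.inr ⟨j, hj⟩)⟩,
          fun h => (h hiA).elim⟩
    · refine ⟨y, ?_, fun h => (hiA h).elim, fun _ => rfl⟩
      rw [hxy' i hiA, dist_self]
      linarith [min_le_left (r i) M]
  choose x' hx'x hx'in hx'out using hx'
  have hr' : ∀ i, 0 ≤ min (r i) M := fun i => le_min (hr i) hM0
  obtain ⟨a, ha, hax⟩ := h.exists_mem_of_bounded_radii hσ hconv y x' (fun i => min (r i) M)
    (K := M)
    (fun i => by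
      by_cases hi : x i ∈ A
      · exact Or.inl (hx'in i hi).1
      · exact Or.inr (hx'out i hi))
    hr' (fun i => min_le_right _ _)
    (fun i ε hε => by
      by_cases hi : x i ∈ A
      · exact ⟨x' i, (hx'in i hi).1, by rw [dist_self]; linarith [hr' i]⟩
      · rw [hx'out i hi]
        rcases le_total (r i) M with hri | hri
        · rw [min_eq_left hri, ← hxy' i hi]
          exact hA i ε hε
        · rw [min_eq_right hri]
          exact ⟨b, hb, by rw [dist_comm]; linarith⟩)
    (fun i j => by
      by_cases hi : x i ∈ A <;> by_cases hj : x j ∈ A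
      · exact (dist_triangle_right _ _ b).trans (add_le_add (hx'in i hi).2.1 (hx'in j hj).2.1)
      · rw [hx'out j hj]
        exact (hx'in i hi).2.2 j hj
      · rw [hx'out i hi, dist_comm, add_comm]
        exact (hx'in j hj).2.2 i hi
      · rw [hx'out i hi, hx'out j hj, dist_self]
        exact add_nonneg (hr' i) (hr' j))
  refine ⟨a, ha, fun i => ?_⟩
  have := dist_triangle a (x' i) (x i)
  linarith [hax i, hx'x i]

end Bicombing

/-! ### Convexity of distance functions along straight curves -/

section Straight

/-- A nonnegative continuous function which at each point of positivity is touched from above by a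
convex function agreeing with it nearby is convex. -/
lemma convexOn_of_eventuallyEq_convexOn {f : ℝ → ℝ} (hf : ContinuousOn f (Icc 0 1))
    (h0 : ∀ t ∈ Icc (0 : ℝ) 1, 0 ≤ f t)
    (h : ∀ t ∈ Icc (0 : ℝ) 1, 0 < f t → ∃ g : ℝ → ℝ, ConvexOn ℝ (Icc 0 1) g ∧
      ∃ η > 0, ∀ s ∈ Icc (0 : ℝ) 1, |s - t| < η → f s = g s) :
    ConvexOn ℝ (Icc 0 1) f := by
  refine ⟨convex_Icc 0 1, ?_⟩
  suffices H : ∀ u ∈ Icc (0 : ℝ) 1, ∀ v ∈ Icc (0 : ℝ) 1, u < v → ∀ w ∈ Icc u v,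
      f w ≤ f u + (w - u) / (v - u) * (f v - f u) by
    intro x hx y hy a b ha hb hab
    simp only [smul_eq_mul]
    obtain rfl : a = 1 - b := by linarith
    rcases lt_trichotomy x y with hxy | rfl | hxy
    · have := H x hx y hy hxy ((1 - b) * x + b * y) ⟨by nlinarith, by nlinarith⟩
      rw [show ((1 - b) * x + b * y - x) / (y - x) = b by
        rw [div_eq_iff (by linarith)]; ring] at this
      linarith
    · rw [← add_mul, ← add_mul]; simp
    · have := H y hy x hx hxy ((1 - b) * x + b * y) ⟨by nlinarith, by nlinarith⟩
      rw [show ((1 - b) * x + b * y - y) / (x - y) = 1 - b by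
        rw [div_eq_iff (by linarith)]; ring] at this
      linarith
  intro u hu v hv huv w hw
  by_contra! hlt
  have huv' : 0 < v - u := by linarith
  set ℓ : ℝ → ℝ := fun t => f u + (t - u) / (v - u) * (f v - f u) with hℓ
  have hsub : Icc u v ⊆ Icc (0 : ℝ) 1 := Icc_subset_Icc hu.1 hv.2
  have hℓ0 : ∀ t ∈ Icc u v, 0 ≤ ℓ t := fun t ht => by
    have h1 : 0 ≤ (t - u) / (v - u) := div_nonneg (by linarith [ht.1]) huv'.le
    have h2 : (t - u) / (v - u) ≤ 1 := (div_le_one huv').2 (by linarith [ht.2])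
    have h3 := h0 u hu
    have h4 := h0 v hv
    simp only [hℓ]
    nlinarith
  have hcont : ContinuousOn (fun t => f t - ℓ t) (Icc u v) :=
    (hf.mono hsub).sub (by fun_prop)
  obtain ⟨m, hm, hmax⟩ := isCompact_Icc.exists_isMaxOn ⟨w, hw⟩ hcont
  have hclosed : IsCompact (Icc u v ∩ (fun t => f t - ℓ t) ⁻¹' {f m - ℓ m}) :=
    isCompact_Icc.of_isClosed_subset (hcont.preimage_isClosed_of_isClosed isClosed_Icc
      isClosed_singleton) inter_subset_left
  -- At the leftmost maximiser of `f - ℓ`, the value at `t - k` is strictly smaller, contradicting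
  -- midpoint convexity of `g`, which equals `f` near `t`.
  obtain ⟨t, ⟨ht, htm⟩, hleast⟩ := hclosed.exists_isLeast ⟨m, hm, rfl⟩
  simp only [mem_preimage, mem_singleton_iff] at htm
  have hpos : 0 < f t - ℓ t := by
    have : f w - ℓ w ≤ f m - ℓ m := hmax hw
    have : 0 < f w - ℓ w := sub_pos.2 hlt
    linarith
  have htu : u < t := lt_of_le_of_ne ht.1 fun h => by
    rw [← h] at hpos
    simp [hℓ] at hpos
  have htv : t < v := lt_of_le_of_ne ht.2 fun h => by
    rw [h] at hpos
    simp [hℓ, div_self huv'.ne'] at hpos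
  obtain ⟨g, hg, η, hη, hfg⟩ := h t (hsub ht) (by linarith [hℓ0 t ht])
  set k := min (η / 2) (min (t - u) (v - t)) with hk
  have hk0 : 0 < k := lt_min (by linarith) (lt_min (by linarith) (by linarith))
  have hkη : k ≤ η / 2 := min_le_left _ _
  have hku : k ≤ t - u := (min_le_right _ _).trans (min_le_left _ _)
  have hkv : k ≤ v - t := (min_le_right _ _).trans (min_le_right _ _)
  have hl : t - k ∈ Icc u v := ⟨by linarith, by linarith⟩
  have hr : t + k ∈ Icc u v := ⟨by linarith, by linarith⟩
  have hconv := hg.2 (hsub hl) (hsub hr) (by norm_num : (0 : ℝ) ≤ 1 / 2)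
    (by norm_num : (0 : ℝ) ≤ 1 / 2) (by norm_num)
  simp only [smul_eq_mul] at hconv
  rw [show 1 / 2 * (t - k) + 1 / 2 * (t + k) = t by ring, ← hfg t (hsub ht) (by simpa using hη),
    ← hfg _ (hsub hl) (by rw [abs_lt]; constructor <;> linarith),
    ← hfg _ (hsub hr) (by rw [abs_lt]; constructor <;> linarith)] at hconv
  have hr' : f (t + k) - ℓ (t + k) ≤ f m - ℓ m := hmax hr
  have hl' : f (t - k) - ℓ (t - k) < f m - ℓ m := by
    refine lt_of_le_of_ne (hmax hl) fun h => ?_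
    have := hleast ⟨hl, h⟩
    linarith
  have hmid : ℓ (t - k) + ℓ (t + k) = 2 * ℓ t := by simp only [hℓ]; ring
  linarith

/-- The distance to an externally hyperconvex set is convex along straight curves. -/
lemma IsExternallyHyperconvexIn.convexOn_infDist {C Y : Set X}
    (hC : IsExternallyHyperconvexIn C Y) (hne : C.Nonempty) {c : ℝ → X}
    (hcY : ∀ t ∈ Icc (0 : ℝ) 1, c t ∈ Y) (hc : ContinuousOn c (Icc 0 1))
    (hconv : ∀ a ∈ C, ConvexOn ℝ (Icc (0 : ℝ) 1) fun t => dist a (c t)) :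
    ConvexOn ℝ (Icc (0 : ℝ) 1) fun t => infDist (c t) C := by
  refine convexOn_of_eventuallyEq_convexOn ((continuous_infDist_pt C).comp_continuousOn hc)
    (fun _ _ => infDist_nonneg) fun t₀ ht₀ hpos => ?_
  -- Within `η` of `t₀` the points `c s`, `c t` are less than half of `infDist (c t₀) C` apart,
  -- while each has distance at least that half from `C`. So the balls about `c t` of radius
  -- `infDist (c t) C` are compatible, and a common point in `C` is nearest to all these `c t` at
  -- once.
  obtain ⟨η, hη, hηc⟩ := Metric.continuousOn_iff.1 hc t₀ ht₀ (infDist (c t₀) C / 4) (by linarith)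
  have hnear : ∀ t ∈ Icc (0 : ℝ) 1, |t - t₀| < η → dist (c t) (c t₀) < infDist (c t₀) C / 4 :=
    fun t ht htη => hηc t ht htη
  have hlow : ∀ t ∈ Icc (0 : ℝ) 1, |t - t₀| < η → infDist (c t₀) C / 2 ≤ infDist (c t) C :=
    fun t ht htη => by
      have h1 : infDist (c t₀) C ≤ infDist (c t) C + dist (c t₀) (c t) := infDist_le_infDist_add_dist
      rw [dist_comm] at h1
      linarith [hnear t ht htη]
  have : Nonempty {t : ℝ // t ∈ Icc (0 : ℝ) 1 ∧ |t - t₀| < η} := ⟨t₀, ht₀, by simpa using hη⟩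
  obtain ⟨a, ha, hac⟩ := hC.exists_mem
    (fun t : {t : ℝ // t ∈ Icc (0 : ℝ) 1 ∧ |t - t₀| < η} => c t) (fun t => infDist (c t) C)
    (fun _ => infDist_nonneg) (fun t => hcY t t.2.1)
    (fun t ε hε => (infDist_lt_iff hne).1 (by linarith))
    (fun s t => by
      have h1 := dist_triangle_right (c s) (c t) (c t₀)
      linarith [hnear s s.2.1 s.2.2, hnear t t.2.1 t.2.2, hlow s s.2.1 s.2.2, hlow t t.2.1 t.2.2])
  refine ⟨_, hconv a ha, η, hη, fun t ht htη => le_antisymm ?_ (hac ⟨t, ht, htη⟩)⟩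
  rw [dist_comm]
  exact infDist_le_dist_of_mem ha

lemma IsExternallyHyperconvexIn.isSigmaConvex {A : Set X} (h : IsExternallyHyperconvexIn A univ)
    {σ : X → X → ℝ → X} (hσ : IsConvexGeodesicBicombing σ) : IsSigmaConvex σ A := by
  rintro x hx y hy _ ⟨t, ht, rfl⟩
  have hconv := h.convexOn_infDist ⟨x, hx⟩ (fun _ _ => mem_univ _) (hσ.continuousOn x y)
    fun a _ => hσ.isStraight x y a
  have h0 : infDist (σ x y t) A ≤ 0 := by
    have := hconv.2 (x := 0) (by simp) (y := 1) (by simp) (sub_nonneg.2 ht.2) ht.1 (by ring)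
    simpa [hσ.start, hσ.finish, infDist_zero_of_mem hx, infDist_zero_of_mem hy] using this
  -- A ball of radius `0` turns distance zero into membership.
  obtain ⟨a, ha, hat⟩ := h.exists_mem (fun _ : Unit => σ x y t) (fun _ => 0) (fun _ => le_rfl)
    (fun _ => mem_univ _) (fun _ ε hε => (infDist_lt_iff ⟨x, hx⟩).1 (by linarith)) (by simp)
  have : a = σ x y t := dist_le_zero.1 (hat ())
  exact this ▸ ha

/-- Intersecting with a closed ball centred at a point of `A` preserves external hyperconvexity. -/
lemma IsExternallyHyperconvexIn.inter_closedBall {A Y Z : Set X}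
    (h : IsExternallyHyperconvexIn A Y) {z : X} {s : ℝ} (hs : 0 ≤ s) (hz : z ∈ Y) (hZY : Z ⊆ Y)
    (hzA : ∀ ε > 0, ∃ b ∈ A, dist z b < s + ε) :
    IsExternallyHyperconvexIn (A ∩ closedBall z s) Z := by
  refine isExternallyHyperconvexIn_of_exists fun ι _ x r hr hxZ hxA hx => ?_
  -- Points of `A ∩ closedBall z s` come arbitrarily close to distance `r i` from `x i`, so the ball
  -- about `z` may join the family.
  have hzx : ∀ i, dist z (x i) ≤ s + r i := fun i => le_of_forall_pos_le_add fun ε hε => by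
    obtain ⟨b, ⟨-, hb⟩, hxb⟩ := hxA i ε hε
    have := dist_triangle_right z (x i) b
    rw [mem_closedBall'] at hb
    linarith
  obtain ⟨a, ha, hax⟩ := h.exists_mem (ι := Option ι) (fun o => o.elim z x) (fun o => o.elim s r)
    (by rintro (_ | i)
        · exact hs
        · exact hr i)
    (by rintro (_ | i)
        · exact hz
        · exact hZY (hxZ i))
    (by rintro (_ | i)
        · exact hzA
        · intro ε hε
          obtain ⟨b, hb, hxb⟩ := hxA i ε hε
          exact ⟨b, hb.1, hxb⟩)
    (by rintro (_ | i) (_ | j)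
        · simpa using hs
        · exact hzx j
        · simpa [dist_comm, add_comm] using hzx i
        · exact hx i j)
  exact ⟨a, ⟨ha, hax none⟩, fun i => hax (some i)⟩

lemma IsExternallyHyperconvexIn.isUniformlyLocally {A : Set X}
    (h : IsExternallyHyperconvexIn A univ) : IsUniformlyLocallyExternallyHyperconvex A :=
  ⟨1, one_pos, fun x hx => h.inter_closedBall zero_le_one (mem_univ _) (subset_univ _)
    (exists_dist_lt_of_dist_le hx (by simp))⟩

lemma IsWeaklyExternallyHyperconvexIn.isUniformlyLocally {A : Set X}
    (h : IsWeaklyExternallyHyperconvexIn A univ) :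
    IsUniformlyLocallyWeaklyExternallyHyperconvex A :=
  ⟨1, one_pos, fun x hx y _ => (h y (mem_univ _)).inter_closedBall zero_le_one (Or.inl hx)
    (union_subset_union_left _ inter_subset_left) (exists_dist_lt_of_dist_le hx (by simp))⟩

/-! ### Straight curves in `A` and in `X` -/

/-- Curves in a weakly externally hyperconvex set `A` which are straight in `A` are straight in the
ambient space. -/
lemma IsWeaklyExternallyHyperconvexIn.isStraight {A : Set X}
    (h : IsWeaklyExternallyHyperconvexIn A univ) {c : ℝ → X} (hcA : ∀ t ∈ Icc (0 : ℝ) 1, c t ∈ A)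
    (hc : ContinuousOn c (Icc 0 1))
    (hconv : ∀ a ∈ A, ConvexOn ℝ (Icc (0 : ℝ) 1) fun t => dist a (c t)) : IsStraight c := by
  intro z
  have hne : A.Nonempty := ⟨c 0, hcA 0 (by simp)⟩
  set s := infDist z A with hs
  have hs0 : 0 ≤ s := infDist_nonneg
  have hzA : ∀ ε > 0, ∃ b ∈ A, dist z b < s + ε := fun ε hε => (infDist_lt_iff hne).1 (by linarith)
  -- Every `a ∈ A` can be joined to `z` without loss of length through a point of `A` nearest to
  -- `z`. Thus on `A` the distance to `z` is `s` plus the distance to `A ∩ closedBall z s`.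
  have hgate : ∀ a ∈ A, ∃ b ∈ A ∩ closedBall z s, dist b a ≤ dist z a - s := fun a ha => by
    have hsa : 0 ≤ dist z a - s := sub_nonneg.2 (infDist_le_dist_of_mem ha)
    obtain ⟨b, hb, hbx⟩ := (h z (mem_univ _)).exists_mem ![z, a] ![s, dist z a - s]
      (by simpa [Fin.forall_fin_two, hs0] using hsa) (by simp [Fin.forall_fin_two, ha])
      (Fin.forall_fin_two.2 ⟨hzA, exists_dist_lt_of_dist_le ha (by simpa using hsa)⟩)
      (by simpa [Fin.forall_fin_two, hs0, dist_comm] using hsa)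
    exact ⟨b, ⟨hb, hbx 0⟩, hbx 1⟩
  have hCne : (A ∩ closedBall z s).Nonempty := by
    obtain ⟨b, hb, -⟩ := hgate _ (hcA 0 (by simp))
    exact ⟨b, hb⟩
  have key := ((h z (mem_univ _)).inter_closedBall (Z := A) hs0 (Or.inr rfl) subset_union_left
    hzA).convexOn_infDist hCne hcA hc fun a ha => hconv a ha.1
  refine (key.add_const s).congr fun t ht => le_antisymm ?_ ?_
  · obtain ⟨b, hb, hbt⟩ := hgate _ (hcA t ht)
    have := infDist_le_dist_of_mem (x := c t) hb
    rw [dist_comm] at this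
    simp only [Pi.add_apply]
    linarith
  · refine le_of_forall_pos_le_add fun ε hε => ?_
    obtain ⟨b, hb, hbt⟩ := (infDist_lt_iff hCne).1 (show infDist (c t) (A ∩ closedBall z s) <
      infDist (c t) (A ∩ closedBall z s) + ε by linarith)
    have h1 := dist_triangle_right z (c t) b
    have h2 := mem_closedBall'.1 hb.2
    simp only [Pi.add_apply]
    linarith

/-- Consistent geodesic bicombings restrict to themselves, with parametrization. -/
lemma IsConsistentGeodesicBicombing.apply_apply {τ : X → X → ℝ → X}
    (hτ : IsConsistentGeodesicBicombing τ) (x y : X) {s t l : ℝ} (hs : 0 ≤ s) (hst : s ≤ t)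
    (ht : t ≤ 1) (hl : l ∈ Icc (0 : ℝ) 1) :
    τ (τ x y s) (τ x y t) l = τ x y ((1 - l) * s + l * t) := by
  obtain ⟨u, hu, hul⟩ := hτ.consistent x y s t hs hst ht ⟨l, hl, rfl⟩
  have hsI : s ∈ Icc (0 : ℝ) 1 := ⟨hs, hst.trans ht⟩
  have htI : t ∈ Icc (0 : ℝ) 1 := ⟨hs.trans hst, ht⟩
  have hw : (1 - l) * s + l * t ∈ Icc (0 : ℝ) 1 :=
    convex_Icc (0 : ℝ) 1 hsI htI (sub_nonneg.2 hl.2) hl.1 (by ring)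
  have h1 := hτ.dist_start (τ x y s) (τ x y t) hl
  have h2 := hτ.dist_finish (τ x y s) (τ x y t) hl
  rw [← hul, hτ.constant_speed x y s hsI t htI, hτ.constant_speed x y s hsI u hu,
    abs_sub_comm s t, abs_of_nonneg (sub_nonneg.2 hst)] at h1
  rw [← hul, hτ.constant_speed x y s hsI t htI, hτ.constant_speed x y u hu t htI,
    abs_sub_comm s t, abs_of_nonneg (sub_nonneg.2 hst)] at h2
  rw [← hul]
  refine dist_le_zero.1 ?_
  rw [hτ.constant_speed x y u hu _ hw]
  -- Since `dist x y` may vanish, it is not cancelled: the parameter comparisons stay multiplied by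
  -- it.
  have hD : 0 ≤ dist x y := dist_nonneg
  rcases le_total u ((1 - l) * s + l * t) with hle | hle
  · rw [abs_sub_comm, abs_of_nonneg (sub_nonneg.2 hle)]
    nlinarith [mul_le_mul_of_nonneg_right (le_abs_self (t - u)) hD, abs_sub_comm u t]
  · rw [abs_of_nonneg (sub_nonneg.2 hle)]
    nlinarith [mul_le_mul_of_nonneg_right (le_abs_self (u - s)) hD, abs_sub_comm u s]

/-- By consistency every subsegment is itself a curve of `τ`, so comparison with the constant curve
at `z` gives the convexity inequality on each subinterval. -/
lemma IsConsistentGeodesicBicombing.isStraight {τ : X → X → ℝ → X}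
    (hτ : IsConsistentGeodesicBicombing τ) (x y : X) : IsStraight (τ x y) := by
  intro z
  refine LinearOrder.convexOn_of_lt (convex_Icc 0 1) ?_
  intro s hs t ht hst a b ha hb hab
  have hbI : b ∈ Icc (0 : ℝ) 1 := ⟨hb.le, by linarith⟩
  obtain rfl : a = 1 - b := by linarith
  simp only [smul_eq_mul]
  rw [← hτ.apply_apply x y hs.1 hst.le ht.2 hbI]
  simpa only [hτ.const z hbI] using hτ.weakly_convex z z (τ x y s) (τ x y t) b hbI

lemma IsWeaklyExternallyHyperconvexIn.isSigmaConvex {A : Set X}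
    (h : IsWeaklyExternallyHyperconvexIn A univ) (huniq : HasUniqueStraightCurves X)
    {τ : A → A → ℝ → A} (hτ : IsConsistentGeodesicBicombing τ)
    {σ : X → X → ℝ → X} (hσ : IsConvexGeodesicBicombing σ) : IsSigmaConvex σ A := by
  rintro x hx y hy _ ⟨t, ht, rfl⟩
  have hst : IsStraight fun t => (τ ⟨x, hx⟩ ⟨y, hy⟩ t : X) :=
    h.isStraight (fun t _ => Subtype.coe_prop _)
      (continuous_subtype_val.comp_continuousOn (hτ.continuousOn _ _))
      fun a ha => hτ.isStraight ⟨x, hx⟩ ⟨y, hy⟩ ⟨a, ha⟩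
  have := huniq _ _ hst (hσ.isStraight x y) (by simp [hτ.start, hσ.start])
    (by simp [hτ.finish, hσ.finish]) ht
  rw [← this]
  exact Subtype.coe_prop _

lemma IsStraight.comp_segment {c : ℝ → X} (hc : IsStraight c) {s t : ℝ}
    (hs : s ∈ Icc (0 : ℝ) 1) (ht : t ∈ Icc (0 : ℝ) 1) :
    IsStraight fun l => c ((1 - l) * s + l * t) := by
  intro z
  refine ⟨convex_Icc 0 1, fun l hl m hm a b ha hb hab => ?_⟩
  have hI : ∀ l ∈ Icc (0 : ℝ) 1, (1 - l) * s + l * t ∈ Icc (0 : ℝ) 1 := fun l hl =>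
    convex_Icc (0 : ℝ) 1 hs ht (sub_nonneg.2 hl.2) hl.1 (by ring)
  have := (hc z).2 (hI l hl) (hI m hm) ha hb hab
  simp only [smul_eq_mul] at this ⊢
  convert this using 3
  obtain rfl : a = 1 - b := by linarith
  ring

/-- Affinely reparametrised subsegments of `σ`-curves are straight, so uniqueness identifies them
with the `σ`-curves between their endpoints. -/
lemma exists_isConsistentGeodesicBicombing {A : Set X} (huniq : HasUniqueStraightCurves X)
    {σ : X → X → ℝ → X} (hσ : IsConvexGeodesicBicombing σ) (hconv : IsSigmaConvex σ A) :
    ∃ τ : A → A → ℝ → A, IsConsistentGeodesicBicombing τ := by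
  classical
  let τ : A → A → ℝ → A := fun x y t =>
    if ht : t ∈ Icc (0 : ℝ) 1 then ⟨σ x y t, hconv x x.2 y y.2 ⟨t, ht, rfl⟩⟩ else x
  have hτ : ∀ (x y : A) (t : ℝ), t ∈ Icc (0 : ℝ) 1 → (τ x y t : X) = σ x y t := fun x y t ht => by
    simp only [τ, dif_pos ht]
  refine ⟨τ, ⟨⟨fun x y => ?_, fun x y => ?_, fun x y s hs t ht => ?_, fun x y t ht => ?_,
    fun x y x' y' t ht => ?_⟩, fun x y s t hs hst ht => ?_⟩⟩
  · exact Subtype.ext (by rw [hτ _ _ _ (by simp), hσ.start])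
  · exact Subtype.ext (by rw [hτ _ _ _ (by simp), hσ.finish])
  · simpa only [Subtype.dist_eq, hτ _ _ _ hs, hτ _ _ _ ht] using hσ.constant_speed x y s hs t ht
  · refine Subtype.ext ?_
    rw [hτ _ _ _ ht, hτ _ _ _ ⟨by linarith [ht.2], by linarith [ht.1]⟩, hσ.symmetric x y t ht]
  · simpa only [Subtype.dist_eq, hτ _ _ _ ht] using hσ.weakly_convex x y x' y' t ht
  · rintro _ ⟨l, hl, rfl⟩
    have hsI : s ∈ Icc (0 : ℝ) 1 := ⟨hs, hst.trans ht⟩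
    have htI : t ∈ Icc (0 : ℝ) 1 := ⟨hs.trans hst, ht⟩
    have hw : (1 - l) * s + l * t ∈ Icc (0 : ℝ) 1 :=
      convex_Icc (0 : ℝ) 1 hsI htI (sub_nonneg.2 hl.2) hl.1 (by ring)
    refine ⟨_, hw, Subtype.ext ?_⟩
    rw [hτ _ _ _ hw, hτ _ _ _ hl, hτ _ _ _ hsI, hτ _ _ _ htI]
    exact huniq _ _ ((hσ.isStraight x y).comp_segment hsI htI) (hσ.isStraight _ _)
      (by simp [hσ.start]) (by simp [hσ.finish]) hl

end Straight

end Bicombing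

theorem mainTheorem3 {X : Type u} [MetricSpace X]
    (hX : Bicombing.IsHyperconvex (Set.univ : Set X)) (A : Set X)
    (σ : X → X → ℝ → X) (hσ : Bicombing.IsConvexGeodesicBicombing σ) :
    (Bicombing.IsExternallyHyperconvexIn A Set.univ ↔
      Bicombing.IsSigmaConvex σ A ∧ Bicombing.IsUniformlyLocallyExternallyHyperconvex A) ∧
    (Bicombing.HasUniqueStraightCurves X →
      ((Bicombing.IsWeaklyExternallyHyperconvexIn A Set.univ ∧
          ∃ τ : A → A → ℝ → A, Bicombing.IsConsistentGeodesicBicombing τ) ↔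
        Bicombing.IsSigmaConvex σ A ∧
          Bicombing.IsUniformlyLocallyWeaklyExternallyHyperconvex A)) := by
  refine ⟨⟨fun h => ⟨h.isSigmaConvex hσ, h.isUniformlyLocally⟩,
    fun ⟨hconv, h⟩ => h.isExternallyHyperconvexIn hX hσ.toIsGeodesicBicombing hconv⟩,
    fun huniq => ⟨fun ⟨h, τ, hτ⟩ => ⟨h.isSigmaConvex huniq hτ hσ, h.isUniformlyLocally⟩,
      fun ⟨hconv, h⟩ => ⟨h.isWeaklyExternallyHyperconvexIn hX hσ.toIsGeodesicBicombing hconv,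
        Bicombing.exists_isConsistentGeodesicBicombing huniq hσ hconv⟩⟩⟩
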